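/- For a subset $S$ of a Hausdorff space $X$, let $\operatorname{Homeo}_S(X)$ be the group of homeomorphisms $h$ of $X$ with $h(x)=x$ for all $x\in X\setminus S$, equipped with the compact-open topology, and let $\mathscr K(X)$ be the set of compact subsets of $X$, directed by inclusion. A directed family of topological groups $\{G_\alpha\}$ (with closed embeddings as bonding maps) satisfies the algebraic colimit property (ACP) if on $G=\bigcup_\alpha G_\alpha$ the finest topology making all inclusions $G_\alpha\to G$ continuous coincides with the finest group topology making all inclusions $G_\alpha\to G$ continuous. Theorem C. Let $X$ be a locally compact metrizable space that is not compact, and suppose that $\operatorname{Homeo}_{\overline U}(X)$ is not locally compact for every non-empty open set $U$ with $\overline U$ compact. Then $\{\operatorname{Homeo}_K(X)\}_{K\in\mathscr K(X)}$ does not satisfy ACP. Theorem C$'$. More generally, let $X$ be a locally compact Hausdorff space that is not compact. Each of the following statements implies all the subsequent ones (the implication (ii) $\Rightarrow$ (v) is Theorem C): (i) $X$ is metrizable, locally Euclidean (every point has an open neighborhood homeomorphic to some $\mathbb R^n$, where $n$ may depend on the point), and has no isolated points; (ii) $X$ is metrizable and $\operatorname{Homeo}_{\overline U}(X)$ is not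 locally compact for every non-empty open set $U$ such that $\overline U$ is compact; (iii) $X$ is normal, locally metrizable (every point has a metrizable neighborhood), and contains (1) a compact subset $M_0$ such that $\operatorname{Homeo}_{M_0}(X)$ is not locally compact, and (2) an infinite discrete closed set $T$ such that for every $t\in T$ and every neighborhood $V$ of $t$ with compact closure, $\operatorname{Homeo}_{\overline V}(X)$ is not discrete; (iv) $X$ contains (1) a compact metrizable subset $M_0$ such that $\operatorname{Homeo}_{M_0}(X)$ is not locally compact, and (2) a regular closed (equal to the closure of its interior), $\sigma$-compact, and metrizable subset $A$ whose interior contains an infinite set $T$, closed in $X$ and discrete, such that for every $t\in T$ and every neighborhood $V$ of $t$ with compact closure, $\operatorname{Homeo}_{\overline V}(X)$ is not discrete; (v) $\{\operatorname{Homeo}_K(X)\}_{K\in\mathscr K(X)}$ does not satisfy ACP. -/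

import Mathlib

open Set Topology TopologicalSpace

universe u v

section ColimitTopologies

variable {Γ : Type u} [Group Γ] {ι : Type v} (G : ι → Subgroup Γ) [∀ i, TopologicalSpace (G i)]

/-- The colimit space topology on the union `⨆ i, G i` of a directed family of subgroups `G i`,
each carrying its own topology: the finest topology making every inclusion `G i → ⨆ i, G i`
continuous. A set is open for it iff its trace on every `G i` is open. -/
def colimitSpaceTopology : TopologicalSpace (⨆ i, G i : Subgroup Γ) :=
  ⨆ i, TopologicalSpace.coinduced (Subgroup.inclusion (le_iSup G i)) inferInstance

/-- The colimit group topology on the union `⨆ i, G i` of a directed family of topological groups: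
the finest group topology making every inclusion `G i → ⨆ i, G i` continuous.
(In the order on topologies, `≤` means "finer than", so the finest one is the infimum.) -/
def colimitGroupTopology : GroupTopology (⨆ i, G i : Subgroup Γ) :=
  sInf {t | ∀ i, @Continuous _ _ _ t.toTopologicalSpace (Subgroup.inclusion (le_iSup G i))}

/-- The algebraic colimit property: the colimit space topology and the colimit group topology
coincide. -/
def SatisfiesACP : Prop :=
  colimitSpaceTopology G = (colimitGroupTopology G).toTopologicalSpace

end ColimitTopologies

section HomeomorphismGroups

variable (X : Type u) [TopologicalSpace X]

/-- The group of homeomorphisms of `X` that fix every point outside `S`. -/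
def homeoOn (S : Set X) : Subgroup (X ≃ₜ X) where
  carrier := {h | ∀ x, x ∉ S → h x = x}
  one_mem' := fun _ _ => rfl
  mul_mem' := by
    intro a b ha hb x hx
    change a (b x) = x
    rw [hb x hx, ha x hx]
  inv_mem' := by
    intro a ha x hx
    change a.symm x = x
    rw [Homeomorph.symm_apply_eq, ha x hx]

/-- The compact-open topology on the group of homeomorphisms of `X` fixing every point outside
`S`. -/
instance homeoOn.instTopologicalSpace (S : Set X) : TopologicalSpace (homeoOn X S) :=
  TopologicalSpace.induced
    (fun h => (⟨h.1, h.1.continuous⟩ : C(X, X))) ContinuousMap.compactOpen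

/-- The family of the groups `homeoOn X K`, indexed by the compact subsets `K` of `X`. -/
abbrev homeoFamily (K : {K : Set X // IsCompact K}) : Subgroup (X ≃ₜ X) := homeoOn X K.1

theorem homeoOn_mono {S T : Set X} (h : S ⊆ T) : homeoOn X S ≤ homeoOn X T :=
  fun _ hf x hx => hf x (fun hS => hx (h hS))

/-- The family is directed, so that its supremum is the union. -/
theorem mem_iSup_homeoFamily (f : X ≃ₜ X) :
    f ∈ (⨆ K, homeoFamily X K) ↔ ∃ K : Set X, IsCompact K ∧ ∀ x, x ∉ K → f x = x := by
  have : Nonempty {K : Set X // IsCompact K} := ⟨⟨∅, isCompact_empty⟩⟩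
  have hd : Directed (· ≤ ·) (homeoFamily X) := fun K L =>
    ⟨⟨K.1 ∪ L.1, K.2.union L.2⟩, homeoOn_mono X subset_union_left,
      homeoOn_mono X subset_union_right⟩
  rw [Subgroup.mem_iSup_of_directed hd]
  exact ⟨fun ⟨K, hK⟩ => ⟨K.1, K.2, hK⟩, fun ⟨K, hK, hf⟩ => ⟨⟨K, hK⟩, hf⟩⟩

end HomeomorphismGroups

section SpaceConditions

variable (X : Type u) [TopologicalSpace X]

/-- Every point has an open neighbourhood homeomorphic to some `ℝⁿ`
(where `n` may depend on the point). -/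
def LocallyEuclidean : Prop :=
  ∀ x : X, ∃ n : ℕ, ∃ U : Set X, IsOpen U ∧ x ∈ U ∧ Nonempty (U ≃ₜ EuclideanSpace ℝ (Fin n))

/-- Every point has a metrizable neighbourhood. -/
def LocallyMetrizable : Prop :=
  ∀ x : X, ∃ V ∈ 𝓝 x, MetrizableSpace V

/-- `T` is infinite, closed and discrete, and for every `t ∈ T` and every neighbourhood `V` of `t`
with compact closure, the group of homeomorphisms that are the identity outside the closure of `V`
is not discrete. -/
def IsHomeoNondiscreteSet (T : Set X) : Prop :=
  T.Infinite ∧ IsClosed T ∧ IsDiscrete T ∧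
    ∀ t ∈ T, ∀ V ∈ 𝓝 t, IsCompact (closure V) → ¬ DiscreteTopology (homeoOn X (closure V))

end SpaceConditions

/-!
The four implications between consecutive statements are proved one by one.

*Locally Euclidean spaces.* A neighbourhood of the identity in `homeoOn X S` contains all
homeomorphisms supported near a given interior point `x` of `S`
(`homeoOn.exists_nhds_forall_mem`). Contracting a ball radially in a chart around `x` yields such a
homeomorphism `h` that fixes `x` and whose iterates move some other point `p` to `x` in the limit
(`exists_homeoOn_iterate_tendsto`). Compactness of the neighbourhood would give a cluster point of
the iterates of `h`, that is, a homeomorphism mapping both `p` and `x` to `x`.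

*Closed discrete sets.* A noncompact metrizable space contains a sequence without cluster points,
whose range is infinite, closed and discrete; and a group that is not locally compact is not
discrete (`exists_isHomeoNondiscreteSet`). In a normal space, extending `t n ↦ n` to a continuous
real function separates the points of a closed discrete sequence `t` by a locally finite family of
neighbourhoods, which can be shrunk to compact metrizable ones; their union is the required
regular closed set (`IsHomeoNondiscreteSet.exists_regularClosed`).

*Failure of the algebraic colimit property.* Let `M` be compact metrizable with `homeoOn X M` not
locally compact, and let `L n` be a locally finite sequence of compact metrizable sets disjoint
from `M` with `homeoOn X (L n)` not discrete. Both kinds of groups are metrizable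
(`homeoOn.metrizableSpace`). Choose a countable basis `B n` of neighbourhoods of the identity in
`homeoOn X M`, for every `n` a sequence `x n k` in `closure (B n)` without cluster point, and a
sequence `y n k ≠ 1` in `homeoOn X (L n)` tending to the identity as `k → ∞`. The set of all
products `x n k * y n k` does not contain `1`. Its trace on `homeoOn X K` is closed for every
compact `K` (`homeoOn.isClosed_setOf_exists_eq_mul`): only finitely many `L n` meet `K`, and for
fixed `n` the products have no cluster point. So its complement `W` is a neighbourhood of `1` in the
colimit space topology. On the other hand, a neighbourhood `V` of `1` contains some `closure (B n)`
and, for this `n`, also `y n k` for large `k`, whence `V * V` is not contained in `W`.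
Multiplication is therefore discontinuous for the colimit space topology.
-/

open Filter

/-! ### The compact-open topology on `homeoOn X S` -/

namespace homeoOn

variable {X : Type u} [TopologicalSpace X] {S T K : Set X}

/-- The continuous self-map of `X` underlying an element of `homeoOn X S`; the compact-open
topology on `homeoOn X S` is by definition induced by this map. -/
def toMap (h : homeoOn X S) : C(X, X) := ⟨h.1, h.1.continuous⟩

@[simp]
theorem toMap_apply (h : homeoOn X S) (x : X) : toMap h x = h.1 x := rfl

theorem isInducing_toMap : IsInducing (toMap : homeoOn X S → C(X, X)) := ⟨rfl⟩

theorem toMap_injective : Function.Injective (toMap : homeoOn X S → C(X, X)) := fun _ _ hab =>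
  Subtype.ext <| Homeomorph.ext fun x => congrArg (fun f : C(X, X) => f x) hab

instance [T2Space X] : T2Space (homeoOn X S) :=
  T2Space.of_injective_continuous toMap_injective isInducing_toMap.continuous

theorem continuous_inclusion (h : S ⊆ T) :
    Continuous (Subgroup.inclusion (homeoOn_mono X h)) :=
  isInducing_toMap.continuous_iff.2 isInducing_toMap.continuous

theorem continuous_apply (x : X) : Continuous fun h : homeoOn X S => h.1 x :=
  (ContinuousEvalConst.continuous_eval_const (F := C(X, X)) x).comp isInducing_toMap.continuous

theorem apply_mem (h : homeoOn X S) {x : X} (hx : x ∈ S) : h.1 x ∈ S := by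
  by_contra hn
  have h1 := h.1.injective (h.2 _ hn)
  rw [h1] at hn
  exact hn hx

/-- Translations are continuous on `homeoOn X S`, for an arbitrary set `S`. -/
instance : SeparatelyContinuousMul (homeoOn X S) where
  continuous_const_mul {a} := isInducing_toMap.continuous_iff.2 <|
    (ContinuousMap.continuous_postcomp (toMap a)).comp isInducing_toMap.continuous
  continuous_mul_const {a} := isInducing_toMap.continuous_iff.2 <|
    (ContinuousMap.continuous_precomp (toMap a)).comp isInducing_toMap.continuous

open scoped Pointwise in
theorem locallyCompactSpace_of_mem_nhds_one [T2Space X] {C : Set (homeoOn X S)}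
    (hC : IsCompact C) (h1 : C ∈ 𝓝 1) : LocallyCompactSpace (homeoOn X S) := by
  suffices WeaklyLocallyCompactSpace (homeoOn X S) from inferInstance
  refine ⟨fun y => ⟨y • C, hC.smul _, ?_⟩⟩
  rw [← preimage_smul_inv]
  exact (continuous_const_smul _).continuousAt.preimage_mem_nhds (by simpa using h1)

/-- The topology of `homeoOn X K` is that of uniform convergence on compact subsets of `K` alone,
because all its elements agree outside `K`. -/
theorem isInducing_restrict (hK : IsClosed K) :
    IsInducing fun h : homeoOn X K => (toMap h).restrict K := by
  refine isInducing_iff_nhds.2 fun h => le_antisymm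
    (((ContinuousMap.continuous_restrict K).comp isInducing_toMap.continuous).tendsto h).le_comap ?_
  refine tendsto_id'.1 <| isInducing_toMap.tendsto_nhds_iff.2 <|
    ContinuousMap.tendsto_nhds_compactOpen.2 fun C hC O hO hCO => ?_
  have hC' : IsCompact ((↑) ⁻¹' C : Set K) := hK.isClosedEmbedding_subtypeVal.isCompact_preimage hC
  have := (ContinuousMap.eventually_mapsTo (f := (toMap h).restrict K) hC' hO
    fun x hx => hCO hx).comap fun h : homeoOn X K => (toMap h).restrict K
  filter_upwards [this] with a ha x hx
  by_cases hxK : x ∈ K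
  · exact ha (x := ⟨x, hxK⟩) hx
  · have h2 := hCO hx
    rw [toMap_apply, h.2 x hxK] at h2
    rwa [Function.comp_apply, id, toMap_apply, a.2 x hxK]

/-- For compact metrizable `K`, restriction to `K` embeds `homeoOn X K` into `C(K, K)`. -/
theorem metrizableSpace [T2Space X] (hK : IsCompact K) [MetrizableSpace K] :
    MetrizableSpace (homeoOn X K) := by
  have : CompactSpace K := isCompact_iff_compactSpace.1 hK
  let := metrizableSpaceMetric K
  let c : homeoOn X K → C(K, K) := fun h =>
    ⟨fun x => ⟨h.1 x, apply_mem h x.2⟩, by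
      exact (h.1.continuous.comp continuous_subtype_val).subtype_mk _⟩
  let j : C(K, X) := ⟨Subtype.val, continuous_subtype_val⟩
  have hc : IsInducing c :=
    ((ContinuousMap.isInducing_postcomp j IsInducing.subtypeVal).of_comp_iff).1
      (isInducing_restrict hK.isClosed)
  have : PseudoMetrizableSpace (homeoOn X K) := hc.pseudoMetrizableSpace
  exact (IsInducing.isEmbedding hc).metrizableSpace

/-- If `x` is a point and `N` a neighbourhood of the identity, then every homeomorphism supported
sufficiently close to `x` belongs to `N`. -/
theorem exists_nhds_forall_mem [T2Space X] {N : Set (homeoOn X S)} (hN : N ∈ 𝓝 1) (x : X) :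
    ∃ V ∈ 𝓝 x, ∀ h : homeoOn X S, h.1 ∈ homeoOn X V → h ∈ N := by
  have hmono : Monotone fun V : Set X => {h : homeoOn X S | h.1 ∈ homeoOn X V} :=
    fun _ _ hVW _ hh => homeoOn_mono X hVW hh
  have key : (𝓝 x).lift' (fun V => {h : homeoOn X S | h.1 ∈ homeoOn X V}) ≤ 𝓝 1 := by
    refine tendsto_id'.1 <| isInducing_toMap.tendsto_nhds_iff.2 <|
      ContinuousMap.tendsto_nhds_compactOpen.2 fun C hC O hO hCO => ?_
    have hCO : C ⊆ O := hCO
    by_cases hx : x ∈ O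
    · filter_upwards [mem_lift' (hO.mem_nhds hx)] with h hh y hy
      by_cases hyO : h.1 y = y
      · simpa [hyO] using hCO hy
      · exact apply_mem (⟨h.1, hh⟩ : homeoOn X O) (hCO hy)
    · filter_upwards [mem_lift' (hC.isClosed.isOpen_compl.mem_nhds fun hxC => hx (hCO hxC))]
        with h hh y hy
      have := hh y (fun hyC => hyC hy)
      simpa [this] using hCO hy
  exact (mem_lift'_sets hmono).1 (key hN)

end homeoOn

/-! ### A closed set witnessing the failure of the algebraic colimit property -/

/-- A noncompact closed subset of a metrizable space contains a sequence without cluster points. -/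
theorem exists_seq_forall_not_mapClusterPt {E : Type*} [TopologicalSpace E] [MetrizableSpace E]
    {s : Set E} (hs : IsClosed s) (hsc : ¬ IsCompact s) :
    ∃ x : ℕ → E, (∀ k, x k ∈ s) ∧ ∀ z, ¬ MapClusterPt z atTop x := by
  let := metrizableSpaceMetric E
  rw [isCompact_iff_isSeqCompact] at hsc
  simp only [IsSeqCompact, not_forall, not_exists, not_and] at hsc
  obtain ⟨x, hx, hxs⟩ := hsc
  refine ⟨x, hx, fun z hz => ?_⟩
  obtain ⟨φ, hφ, hlim⟩ := hz.tendsto_subseq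
  exact hxs z (hs.mem_of_tendsto hlim (Eventually.of_forall fun k => hx _)) φ hφ hlim

/-- A nondiscrete metrizable group with continuous translations contains a sequence of nontrivial
elements converging to `1`. -/
theorem exists_seq_ne_one_tendsto_one {E : Type*} [Group E] [TopologicalSpace E]
    [SeparatelyContinuousMul E] [MetrizableSpace E] (hE : ¬ DiscreteTopology E) :
    ∃ y : ℕ → E, (∀ k, y k ≠ 1) ∧ Tendsto y atTop (𝓝 1) := by
  have h1 : (1 : E) ∈ closure {1}ᶜ := by
    rw [closure_compl, mem_compl_iff]
    intro h
    refine hE (discreteTopology_of_isOpen_singleton_one ?_)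
    rw [isOpen_singleton_iff_nhds_eq_pure]
    exact le_antisymm (le_pure_iff.2 (mem_interior_iff_mem_nhds.1 h)) (pure_le_nhds 1)
  exact mem_closure_iff_seq_limit.1 h1

namespace homeoOn

variable {X : Type u} [TopologicalSpace X] {K L M : Set X}

/-- If `g` lives on a set disjoint from the support of `f`, then `f * g` moves the points that `g`
moves. -/
theorem exists_mem_mul_apply_ne (hLM : Disjoint L M) (f : homeoOn X M) {g : homeoOn X L}
    (hg : g ≠ 1) : ∃ p ∈ L, (f.1 * g.1) p ≠ p := by
  have : ∃ p, g.1 p ≠ p := by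
    by_contra! h
    exact hg (Subtype.ext (Homeomorph.ext h))
  obtain ⟨p, hp⟩ := this
  have hpL : p ∈ L := by
    by_contra h
    exact hp (g.2 p h)
  refine ⟨p, hpL, ?_⟩
  change f.1 (g.1 p) ≠ p
  rwa [f.2 _ (disjoint_left.1 hLM (apply_mem g hpL))]

theorem mul_ne_of_disjoint (hLM : Disjoint L M) (hLK : Disjoint L K) (f : homeoOn X M)
    {g : homeoOn X L} (hg : g ≠ 1) (h : homeoOn X K) : h.1 ≠ f.1 * g.1 := by
  obtain ⟨p, hpL, hp⟩ := exists_mem_mul_apply_ne hLM f hg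
  intro heq
  exact hp (heq ▸ h.2 p (disjoint_left.1 hLK hpL))

/-- If `x` has no cluster point in `homeoOn X M` and `y` tends to the identity with support away
from `M`, then the products `x k * y k` do not accumulate at any homeomorphism. -/
theorem not_mapClusterPt_comp [T2Space X] (hM : IsClosed M) (hLM : Disjoint L M)
    {x : ℕ → homeoOn X M} (hx : ∀ z, ¬ MapClusterPt z atTop x)
    {y : ℕ → homeoOn X L} (hy : Tendsto y atTop (𝓝 1)) (z : homeoOn X K) :
    ¬ MapClusterPt (toMap z) atTop fun k => (toMap (x k)).comp (toMap (y k)) := by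
  intro hz
  -- Off `M` the products agree with `y k`, hence converge to the identity pointwise.
  have hzM : ∀ p, p ∉ M → z.1 p = p := by
    intro p hp
    have h1 : MapClusterPt (z.1 p) atTop fun k => (x k).1 ((y k).1 p) :=
      hz.continuousAt_comp (f := fun f : C(X, X) => f p)
        (continuous_eval_const p).continuousAt
    have h2 : ∀ k, (x k).1 ((y k).1 p) = (y k).1 p := by
      intro k
      refine (x k).2 _ ?_
      by_cases hpL : p ∈ L
      · exact disjoint_left.1 hLM (apply_mem _ hpL)
      · rwa [(y k).2 p hpL]
    simp only [h2] at h1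
    have h3 : Tendsto (fun k => (y k).1 p) atTop (𝓝 p) := ((continuous_apply p).tendsto 1).comp hy
    exact eq_of_nhds_neBot (NeBot.mono h1 (inf_le_inf_left _ h3))
  refine hx ⟨z.1, hzM⟩ ((isInducing_restrict hM).mapClusterPt_iff (l := map x atTop) |>.1 ?_)
  -- On `M` the products agree with `x k`.
  have h4 := hz.continuousAt_comp (ContinuousMap.continuous_restrict M).continuousAt
  have h5 : (fun k => ((toMap (x k)).comp (toMap (y k))).restrict M) =
      fun k => (toMap (x k)).restrict M := by
    funext k
    ext p
    have : (y k).1 p = p := (y k).2 _ fun h => disjoint_left.1 hLM h p.2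
    simp [this]
  exact (congrArg (MapClusterPt _ atTop) h5).mp h4

/-- The set of products `x n k * y n k` has closed trace on `homeoOn X K` for every compact `K`:
such a trace involves only finitely many `n`. -/
theorem isClosed_setOf_exists_eq_mul [T2Space X] (hK : IsCompact K) (hM : IsClosed M)
    {L : ℕ → Set X} (hL : LocallyFinite L) (hLM : ∀ n, Disjoint (L n) M)
    {x : ℕ → ℕ → homeoOn X M} (hx : ∀ n z, ¬ MapClusterPt z atTop (x n))
    {y : ∀ n, ℕ → homeoOn X (L n)} (hy1 : ∀ n k, y n k ≠ 1)
    (hy : ∀ n, Tendsto (y n) atTop (𝓝 1)) :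
    IsClosed {h : homeoOn X K | ∃ n k, h.1 = (x n k).1 * (y n k).1} := by
  rw [← isOpen_compl_iff, isOpen_iff_mem_nhds]
  intro z hz
  simp only [mem_compl_iff, mem_ofPred_eq, not_exists] at hz
  have hfin : {n | (L n ∩ K).Nonempty}.Finite := hL.finite_nonempty_inter_compact hK
  have key : ∀ n ∈ {n | (L n ∩ K).Nonempty},
      ∀ᶠ h : homeoOn X K in 𝓝 z, ∀ k, h.1 ≠ (x n k).1 * (y n k).1 := by
    intro n _
    have hnc := not_mapClusterPt_comp hM (hLM n) (hx n) (hy n) z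
    simp only [mapClusterPt_iff_frequently, not_forall, not_frequently] at hnc
    obtain ⟨s, hs, hev⟩ := hnc
    obtain ⟨m, hm⟩ := eventually_atTop.1 hev
    have hlow : ∀ k ∈ Iio m, ∀ᶠ h : homeoOn X K in 𝓝 z, h.1 ≠ (x n k).1 * (y n k).1 := by
      intro k _
      have hsub : {h : homeoOn X K | h.1 = (x n k).1 * (y n k).1}.Subsingleton :=
        fun a ha b hb => Subtype.ext (ha.trans hb.symm)
      exact hsub.finite.isClosed.isOpen_compl.mem_nhds (hz n k)
    filter_upwards [isInducing_toMap.continuous.continuousAt.preimage_mem_nhds hs,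
      (eventually_all_finite (finite_Iio m)).2 hlow] with h hh hl k
    rcases lt_or_ge k m with hk | hk
    · exact hl k hk
    · rintro heq
      refine hm k hk ?_
      have : toMap h = (toMap (x n k)).comp (toMap (y n k)) :=
        ContinuousMap.ext fun p => congrArg (fun g : X ≃ₜ X => g p) heq
      rwa [mem_preimage, this] at hh
  filter_upwards [(eventually_all_finite hfin).2 key] with h hh
  rintro ⟨n, k, heq⟩
  by_cases hn : (L n ∩ K).Nonempty
  · exact hh n hn k heq
  · exact mul_ne_of_disjoint (hLM n) (disjoint_iff_inter_eq_empty.2 (not_nonempty_iff_eq_empty.1 hn))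
      _ (hy1 n k) h heq

end homeoOn

open homeoOn in
/-- The algebraic colimit property fails as soon as some compact metrizable `M` supports a group of
homeomorphisms that is not locally compact, and some locally finite sequence of compact metrizable
sets away from `M` supports nondiscrete groups. -/
theorem not_satisfiesACP_of_locallyFinite {X : Type u} [TopologicalSpace X] [T2Space X]
    {M : Set X} (hM : IsCompact M) [MetrizableSpace M]
    (hMlc : ¬ LocallyCompactSpace (homeoOn X M)) {L : ℕ → Set X} (hLc : ∀ n, IsCompact (L n))
    (hLm : ∀ n, MetrizableSpace (L n)) (hL : LocallyFinite L) (hLM : ∀ n, Disjoint (L n) M)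
    (hLd : ∀ n, ¬ DiscreteTopology (homeoOn X (L n))) :
    ¬ SatisfiesACP (homeoFamily X) := by
  intro hACP
  have := metrizableSpace hM
  have := fun n => metrizableSpace (hLc n)
  obtain ⟨B, hB⟩ := (𝓝 (1 : homeoOn X M)).exists_antitone_basis
  have hex : ∀ n, ∃ x : ℕ → homeoOn X M,
      (∀ k, x k ∈ closure (B n)) ∧ ∀ z, ¬ MapClusterPt z atTop x := fun n =>
    exists_seq_forall_not_mapClusterPt isClosed_closure fun hc =>
      hMlc <| locallyCompactSpace_of_mem_nhds_one hc <|
        mem_of_superset (hB.1.mem_of_mem trivial) subset_closure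
  choose x hxB hx using hex
  choose y hy1 hy using fun n => exists_seq_ne_one_tendsto_one (hLd n)
  let τ : TopologicalSpace (⨆ K, homeoFamily X K : Subgroup (X ≃ₜ X)) :=
    colimitSpaceTopology (homeoFamily X)
  have hτ : IsTopologicalGroup (⨆ K, homeoFamily X K : Subgroup (X ≃ₜ X)) := by
    have h := (colimitGroupTopology (homeoFamily X)).toIsTopologicalGroup
    rwa [← show τ = _ from hACP] at h
  let j (K : {K : Set X // IsCompact K}) := Subgroup.inclusion (le_iSup (homeoFamily X) K)
  have hj (K) : Tendsto (j K) (𝓝 1) (𝓝 1) := by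
    have : Continuous (j K) := continuous_iff_coinduced_le.2 (le_iSup
      (fun K => coinduced (Subgroup.inclusion (le_iSup (homeoFamily X) K)) inferInstance) K)
    simpa using this.tendsto 1
  -- `W` is a neighbourhood of `1` that contains no product `V * V` of neighbourhoods of `1`.
  let W : Set (⨆ K, homeoFamily X K : Subgroup (X ≃ₜ X)) :=
    {g | ∃ n k, g.1 = (x n k).1 * (y n k).1}ᶜ
  have hW : IsOpen W := by
    refine isOpen_iSup_iff.2 fun K => isOpen_coinduced.2 ?_
    exact (isClosed_setOf_exists_eq_mul K.2 hM.isClosed hL hLM hx hy1 hy).isOpen_compl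
  have hW1 : W ∈ 𝓝 1 := by
    refine hW.mem_nhds ?_
    rintro ⟨n, k, h⟩
    exact mul_ne_of_disjoint (hLM n) (disjoint_empty _) _ (hy1 n k)
      (1 : homeoOn X ∅) h
  obtain ⟨V, hV, hVW⟩ := exists_nhds_one_split hW1
  obtain ⟨n, hn⟩ : ∃ n, closure (B n) ⊆ j ⟨M, hM⟩ ⁻¹' V := by
    obtain ⟨s, hs, hsc, hsV⟩ := exists_mem_nhds_isClosed_subset (hj ⟨M, hM⟩ hV)
    obtain ⟨n, -, hn⟩ := hB.1.mem_iff.1 hs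
    exact ⟨n, (closure_minimal hn hsc).trans hsV⟩
  obtain ⟨k, hk⟩ := ((hy n).eventually (hj ⟨L n, hLc n⟩ hV)).exists
  exact hVW _ (hn (hxB n k)) _ hk ⟨n, k, rfl⟩

/-! ### Separating the points of a closed discrete set -/

/-- In a normal space, the points of a closed discrete sequence have a locally finite family of
open neighbourhoods: extend `t n ↦ n` to a continuous real function. -/
theorem exists_locallyFinite_nhds_of_isDiscrete {Y : Type*} [TopologicalSpace Y] [NormalSpace Y]
    {T : Set Y} (hTc : IsClosed T) (hTd : IsDiscrete T) {t : ℕ → Y} (ht : Function.Injective t)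
    (htT : ∀ n, t n ∈ T) :
    ∃ U : ℕ → Set Y, (∀ n, U n ∈ 𝓝 (t n)) ∧ LocallyFinite U := by
  have := hTd.to_subtype
  have he : IsClosedEmbedding t := by
    refine .of_continuous_injective_isClosedMap continuous_of_discreteTopology ht fun s _ => ?_
    have h1 : t '' s ⊆ T := image_subset_iff.2 fun n _ => htT n
    rw [← inter_eq_self_of_subset_right h1, ← Subtype.image_preimage_coe]
    exact hTc.isClosedEmbedding_subtypeVal.isClosedMap _ (isClosed_discrete _)
  obtain ⟨g, hg⟩ := ContinuousMap.exists_extension' (Y := ℝ) he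
    ⟨fun n : ℕ => (n : ℝ), continuous_of_discreteTopology⟩
  have hgt (n) : g (t n) = n := congrFun hg n
  refine ⟨fun n => g ⁻¹' Metric.ball (n : ℝ) 1, fun n => ?_, ?_⟩
  · exact g.continuous.continuousAt.preimage_mem_nhds (by
      rw [hgt]; exact Metric.ball_mem_nhds _ one_pos)
  · refine LocallyFinite.preimage_continuous (f := fun n : ℕ => Metric.ball (n : ℝ) 1)
      (fun r => ⟨Metric.ball r 1, Metric.ball_mem_nhds _ one_pos, ?_⟩) g.continuous
    refine (finite_Iio ⌈r + 2⌉₊).subset ?_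
    rintro n ⟨s, hs1, hs2⟩
    rw [Metric.mem_ball, Real.dist_eq, abs_lt] at hs1 hs2
    exact Nat.lt_ceil.2 (by linarith)

/-- The image in `X` of a locally finite family of subsets of a closed subspace is locally
finite. -/
theorem LocallyFinite.image_val_of_isClosed {X ι : Type*} [TopologicalSpace X] {A : Set X}
    (hA : IsClosed A) {U : ι → Set A} (hU : LocallyFinite U) :
    LocallyFinite fun i => ((↑) '' U i : Set X) := by
  intro p
  by_cases hp : p ∈ A
  · obtain ⟨s, hs, hfin⟩ := hU ⟨p, hp⟩
    obtain ⟨s', hs', hsub⟩ := mem_nhds_subtype A _ s |>.1 hs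
    refine ⟨s', hs', hfin.subset ?_⟩
    rintro i ⟨_, ⟨a, ha, rfl⟩, has⟩
    exact ⟨a, ha, hsub has⟩
  · refine ⟨Aᶜ, hA.isOpen_compl.mem_nhds hp, ?_⟩
    convert finite_empty
    rw [eq_empty_iff_forall_notMem]
    rintro i ⟨_, ⟨a, ha, rfl⟩, has⟩
    exact has a.2

theorem not_discreteTopology_homeoOn_mono {X : Type u} [TopologicalSpace X] {S T : Set X}
    (hST : S ⊆ T) (hS : ¬ DiscreteTopology (homeoOn X S)) :
    ¬ DiscreteTopology (homeoOn X T) := fun _ =>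
  hS <| DiscreteTopology.of_continuous_injective (homeoOn.continuous_inclusion hST)
    (Subgroup.inclusion_injective _)

theorem IsHomeoNondiscreteSet.not_discreteTopology {X : Type u} [TopologicalSpace X] [T2Space X]
    {T : Set X} (hT : IsHomeoNondiscreteSet X T) {t : X} (ht : t ∈ T) {L : Set X}
    (hL : IsCompact L) (htL : L ∈ 𝓝 t) : ¬ DiscreteTopology (homeoOn X L) := by
  have h := hT.2.2.2 t ht L htL
  rw [hL.isClosed.closure_eq] at h
  exact h hL

/-- Only finitely many points of `T` lie in the compact set `M`; the others have a locally finite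
family of compact neighbourhoods inside `A` and away from `M`, on which
`not_satisfiesACP_of_locallyFinite` applies. -/
theorem not_satisfiesACP_of_isHomeoNondiscreteSet {X : Type u} [TopologicalSpace X]
    [LocallyCompactSpace X] [T2Space X] {M : Set X} (hM : IsCompact M) [MetrizableSpace M]
    (hMlc : ¬ LocallyCompactSpace (homeoOn X M)) {A : Set X} (hA : IsClosed A) [MetrizableSpace A]
    {T : Set X} (hTA : T ⊆ interior A) (hT : IsHomeoNondiscreteSet X T) :
    ¬ SatisfiesACP (homeoFamily X) := by
  have hfin : (M ∩ T).Finite :=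
    (hM.inter_right hT.2.1).finite (hT.2.2.1.mono inter_subset_right)
  have hinf : (T \ M).Infinite := by
    intro h
    exact hT.1 ((h.union hfin).subset fun p hp => by
      by_cases hpM : p ∈ M
      · exact Or.inr ⟨hpM, hp⟩
      · exact Or.inl ⟨hp, hpM⟩)
  let t := hinf.natEmbedding
  have htA (n) : (t n : X) ∈ interior A := hTA (t n).2.1
  have := hT.2.2.1.to_subtype
  obtain ⟨U, hU, hUf⟩ := exists_locallyFinite_nhds_of_isDiscrete
    (T := ((↑) ⁻¹' T : Set A)) (hT.2.1.preimage continuous_subtype_val)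
    (hT.2.2.1.preimage continuous_subtype_val.continuousOn Subtype.val_injective)
    (t := fun n => ⟨t n, interior_subset (htA n)⟩)
    (fun m n h => t.injective (Subtype.ext (Subtype.mk.inj h))) (fun n => (t n).2.1)
  have hUX (n) : ((↑) '' U n : Set X) ∈ 𝓝 (t n : X) := by
    rw [← map_nhds_subtype_coe_eq_nhds (interior_subset (htA n))
      (mem_interior_iff_mem_nhds.1 (htA n))]
    exact image_mem_map (hU n)
  have hex (n) : ∃ L ∈ 𝓝 (t n : X), L ⊆ ((↑) '' U n : Set X) ∩ Mᶜ ∧ IsCompact L :=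
    local_compact_nhds (inter_mem (hUX n) (hM.isClosed.isOpen_compl.mem_nhds (t n).2.2))
  choose L hLt hLU hLc using hex
  refine not_satisfiesACP_of_locallyFinite hM hMlc hLc (fun n => ?_)
    ((hUf.image_val_of_isClosed hA).subset fun n => (hLU n).trans inter_subset_left)
    (fun n => disjoint_left.2 fun p hp => (hLU n hp).2)
    fun n => hT.not_discreteTopology (t n).2.1 (hLc n) (hLt n)
  have hLA : L n ⊆ A := fun p hp => by
    obtain ⟨a, -, rfl⟩ := (hLU n hp).1
    exact a.2
  exact (IsEmbedding.inclusion hLA).metrizableSpace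

/-! ### Metrizability of Lindelöf subsets -/

/-- A Lindelöf subset of a locally compact, locally metrizable Hausdorff space is covered by
countably many open second countable sets, hence metrizable by Urysohn's theorem. -/
theorem IsLindelof.metrizableSpace {X : Type u} [TopologicalSpace X] [LocallyCompactSpace X]
    [T2Space X] (hX : LocallyMetrizable X) {A : Set X} (hA : IsLindelof A) : MetrizableSpace A := by
  have hex (x : X) : ∃ W : Set X, IsOpen W ∧ x ∈ W ∧ SecondCountableTopology W := by
    obtain ⟨V, hV, hVm⟩ := hX x
    obtain ⟨C, hCx, hCV, hC⟩ := local_compact_nhds hV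
    have : MetrizableSpace C := (IsEmbedding.inclusion hCV).metrizableSpace
    have : CompactSpace C := isCompact_iff_compactSpace.1 hC
    let := metrizableSpaceMetric C
    have : SecondCountableTopology C := inferInstance
    exact ⟨interior C, isOpen_interior, mem_interior_iff_mem_nhds.2 hCx,
      (IsEmbedding.inclusion interior_subset).secondCountableTopology⟩
  choose W hWo hxW hW using hex
  obtain ⟨r, hr, hAr⟩ := hA.elim_countable_subcover W hWo fun x _ => mem_iUnion.2 ⟨x, hxW x⟩
  have : Countable r := hr
  let U (i : r) : Set A := (↑) ⁻¹' W i
  have (i : r) : SecondCountableTopology (U i) := by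
    let f : U i → W i := fun p => ⟨p.1.1, p.2⟩
    have hval : IsInducing ((Subtype.val : A → X) ∘ (Subtype.val : U i → A)) :=
      IsInducing.subtypeVal.comp IsInducing.subtypeVal
    have hf : IsInducing f := (IsInducing.subtypeVal.of_comp_iff (f := f)).1 hval
    exact hf.secondCountableTopology
  have : SecondCountableTopology A := by
    refine secondCountableTopology_of_countable_cover (U := U)
      (fun i => (hWo i).preimage continuous_subtype_val) (eq_univ_of_forall fun a => ?_)
    obtain ⟨i, hi, hai⟩ := mem_iUnion₂.1 (hAr a.2)
    exact mem_iUnion.2 ⟨⟨i, hi⟩, hai⟩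
  infer_instance

/-- In a normal, locally compact, locally metrizable space, an infinite closed discrete set can be
thinned out so as to lie in the interior of a regular closed, `σ`-compact, metrizable set. -/
theorem IsHomeoNondiscreteSet.exists_regularClosed {X : Type u} [TopologicalSpace X]
    [LocallyCompactSpace X] [T2Space X] [NormalSpace X] (hX : LocallyMetrizable X)
    {T : Set X} (hT : IsHomeoNondiscreteSet X T) :
    ∃ A : Set X, A = closure (interior A) ∧ IsSigmaCompact A ∧ MetrizableSpace A ∧
      ∃ T : Set X, T ⊆ interior A ∧ IsHomeoNondiscreteSet X T := by
  let t := hT.1.natEmbedding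
  have htinj : Function.Injective fun n => (t n : X) := Subtype.val_injective.comp t.injective
  obtain ⟨U, hU, hUf⟩ := exists_locallyFinite_nhds_of_isDiscrete hT.2.1 hT.2.2.1 htinj
    fun n => (t n).2
  choose L hLt hLU hLc using fun n => local_compact_nhds (hU n)
  let V n := interior (L n)
  have hVL n : closure (V n) ⊆ L n := closure_minimal interior_subset (hLc n).isClosed
  have hVf : LocallyFinite fun n => closure (V n) := hUf.subset fun n => (hVL n).trans (hLU n)
  let A := ⋃ n, closure (V n)
  have hAc : IsClosed A := hVf.isClosed_iUnion fun n => isClosed_closure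
  have hVA n : V n ⊆ interior A :=
    interior_maximal (subset_closure.trans (subset_iUnion (fun n => closure (V n)) n)) isOpen_interior
  have hA : IsSigmaCompact A :=
    isSigmaCompact_iUnion_of_isCompact _ fun n => (hLc n).of_isClosed_subset isClosed_closure (hVL n)
  have hsub : range (fun n => (t n : X)) ⊆ T := range_subset_iff.2 fun n => (t n).2
  refine ⟨A, ?_, hA, hA.isLindelof.metrizableSpace hX, range fun n => (t n : X), ?_, ?_, ?_, ?_, ?_⟩
  · exact Subset.antisymm (iUnion_subset fun n => closure_mono (hVA n))
      (closure_minimal interior_subset hAc)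
  · exact range_subset_iff.2 fun n => hVA n (mem_interior_iff_mem_nhds.2 (hLt n))
  · exact infinite_range_of_injective htinj
  · have := hT.2.2.1.to_subtype
    rw [← inter_eq_self_of_subset_right hsub, ← Subtype.image_preimage_coe]
    exact hT.2.1.isClosedEmbedding_subtypeVal.isClosedMap _ (isClosed_discrete _)
  · exact hT.2.2.1.mono hsub
  · exact fun s hs => hT.2.2.2 s (hsub hs)

/-! ### Closed discrete sets in noncompact metrizable spaces -/

theorem exists_infinite_isClosed_isDiscrete (X : Type*) [TopologicalSpace X] [MetrizableSpace X]
    [NoncompactSpace X] : ∃ T : Set X, T.Infinite ∧ IsClosed T ∧ IsDiscrete T := by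
  obtain ⟨x, -, hx⟩ := exists_seq_forall_not_mapClusterPt (E := X) isClosed_univ
    (noncompact_univ X)
  have hlf : LocallyFinite fun k => ({x k} : Set X) := by
    intro z
    have hz := hx z
    simp only [mapClusterPt_iff_frequently, not_forall, not_frequently] at hz
    obtain ⟨s, hs, hev⟩ := hz
    refine ⟨s, hs, ?_⟩
    rw [← Nat.cofinite_eq_atTop] at hev
    refine (eventually_cofinite.1 hev).subset fun k hk => ?_
    simpa using hk
  have hcl {S : Set X} (hS : S ⊆ range x) : IsClosed S := by
    have : S = ⋃ k, S ∩ {x k} := by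
      rw [← inter_iUnion, iUnion_singleton_eq_range, inter_eq_self_of_subset_left hS]
    rw [this]
    exact (hlf.subset fun k => inter_subset_right).isClosed_iUnion fun k =>
      ((finite_singleton _).subset inter_subset_right).isClosed
  refine ⟨range x, fun hfin => ?_, hcl Subset.rfl, ⟨discreteTopology_iff_forall_isClosed.2 fun S =>
    (IsInducing.subtypeVal.isClosed_iff).2 ⟨_, hcl (Subtype.coe_image_subset _ S),
      preimage_image_eq _ Subtype.val_injective⟩⟩⟩
  refine infinite_univ (hfin.preimage' (f := x) (fun z _ => ?_) |>.subset fun k _ => mem_range_self k)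
  refine (hlf.point_finite z).subset fun k hk => ?_
  exact (mem_singleton_iff.1 hk).symm

/-- If no group `homeoOn X (closure U)` with `U` nonempty, open and relatively compact is locally
compact, then any infinite closed discrete set is as required, since discrete groups are locally
compact. -/
theorem exists_isHomeoNondiscreteSet (X : Type u) [TopologicalSpace X] [MetrizableSpace X]
    [NoncompactSpace X] (h : ∀ U : Set X, IsOpen U → U.Nonempty → IsCompact (closure U) →
      ¬ LocallyCompactSpace (homeoOn X (closure U))) :
    ∃ T : Set X, IsHomeoNondiscreteSet X T := by
  obtain ⟨T, hT, hTc, hTd⟩ := exists_infinite_isClosed_isDiscrete X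
  refine ⟨T, hT, hTc, hTd, fun t _ V hV hVc => ?_⟩
  have hsub : closure (interior V) ⊆ closure V := closure_mono interior_subset
  refine not_discreteTopology_homeoOn_mono hsub fun hd => ?_
  exact h (interior V) isOpen_interior ⟨t, mem_interior_iff_mem_nhds.2 hV⟩
    (hVc.of_isClosed_subset isClosed_closure hsub) inferInstance

/-! ### Locally Euclidean spaces -/

/-- The radial homeomorphism of a normed space given by `y ↦ ((1 + ‖y‖) / 2) • y` on the unit ball
and by the identity outside. Its iterates contract the open unit ball to the origin. -/
noncomputable def radialHomeomorph (E : Type*) [NormedAddCommGroup E] [NormedSpace ℝ E] :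
    E ≃ₜ E where
  toFun y := ((1 + min ‖y‖ 1) / 2) • y
  -- The scaling factor comes from solving `t = s * (1 + s) / 2` for `s`.
  invFun z := (4 / (1 + √(1 + 8 * min ‖z‖ 1))) • z
  left_inv y := by
    have h0 : 0 ≤ (1 + min ‖y‖ 1) / 2 := by positivity
    simp only [norm_smul, Real.norm_of_nonneg h0, smul_smul]
    convert one_smul ℝ y
    rcases le_total ‖y‖ 1 with h | h
    · have h1 : (1 + ‖y‖) / 2 * ‖y‖ ≤ 1 := by nlinarith [norm_nonneg y]
      rw [min_eq_left h, min_eq_left h1,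
        show 1 + 8 * ((1 + ‖y‖) / 2 * ‖y‖) = (1 + 2 * ‖y‖) ^ 2 by ring,
        Real.sqrt_sq (by positivity)]
      have : 1 + ‖y‖ ≠ 0 := by positivity
      field_simp
      ring
    · rw [min_eq_right h, min_eq_right (by linarith),
        show (1 + 8 * 1 : ℝ) = 3 ^ 2 by norm_num, Real.sqrt_sq (by norm_num)]
      norm_num
  right_inv z := by
    have h0 : 0 ≤ 4 / (1 + √(1 + 8 * min ‖z‖ 1)) := by positivity
    simp only [norm_smul, Real.norm_of_nonneg h0, smul_smul]
    convert one_smul ℝ z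
    rcases le_total ‖z‖ 1 with h | h
    · rw [min_eq_left h]
      set r := √(1 + 8 * ‖z‖) with hr
      have hr0 : 0 ≤ r := Real.sqrt_nonneg _
      have hr2 : r ^ 2 = 1 + 8 * ‖z‖ := Real.sq_sqrt (by positivity)
      have hr3 : r ≤ 3 := by nlinarith
      have h1 : 4 / (1 + r) * ‖z‖ = (r - 1) / 2 := by
        field_simp
        linarith
      rw [h1, min_eq_left (by linarith)]
      field_simp
      ring
    · rw [min_eq_right h, show (1 + 8 * 1 : ℝ) = 3 ^ 2 by norm_num, Real.sqrt_sq (by norm_num),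
        min_eq_right (by linarith)]
      norm_num
  continuous_toFun := by fun_prop
  continuous_invFun := by
    refine Continuous.smul (Continuous.div (by fun_prop) (by fun_prop) fun z => ?_) continuous_id
    positivity

section Radial

variable {E : Type*} [NormedAddCommGroup E] [NormedSpace ℝ E]

theorem radialHomeomorph_apply (y : E) :
    radialHomeomorph E y = ((1 + min ‖y‖ 1) / 2) • y := rfl

theorem radialHomeomorph_of_one_le {y : E} (hy : 1 ≤ ‖y‖) : radialHomeomorph E y = y := by
  rw [radialHomeomorph_apply, min_eq_right hy]
  norm_num

theorem norm_radialHomeomorph_iterate_le {y : E} (hy : ‖y‖ ≤ 1 / 2) (n : ℕ) :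
    ‖(radialHomeomorph E)^[n] y‖ ≤ (3 / 4) ^ n * ‖y‖ := by
  induction n with
  | zero => simp
  | succ n ih =>
    set w := (radialHomeomorph E)^[n] y
    have hw : ‖w‖ ≤ 1 / 2 := by
      refine ih.trans (le_trans ?_ hy)
      exact mul_le_of_le_one_left (norm_nonneg y) (pow_le_one₀ (by norm_num) (by norm_num))
    rw [Function.iterate_succ_apply', radialHomeomorph_apply, norm_smul,
      Real.norm_of_nonneg (by positivity), pow_succ', mul_assoc]
    refine mul_le_mul ?_ ih (norm_nonneg _) (by norm_num)
    linarith [min_le_left ‖w‖ 1]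

theorem tendsto_radialHomeomorph_iterate {y : E} (hy : ‖y‖ ≤ 1 / 2) :
    Tendsto (fun n => (radialHomeomorph E)^[n] y) atTop (𝓝 0) := by
  refine squeeze_zero_norm (norm_radialHomeomorph_iterate_le hy) ?_
  simpa using (tendsto_pow_atTop_nhds_zero_of_lt_one (r := (3 / 4 : ℝ)) (by norm_num)
    (by norm_num)).mul_const ‖y‖

end Radial

section Extension

variable {X : Type u} [TopologicalSpace X] {E : Type*} [TopologicalSpace E] {U : Set X}

open Classical in
/-- A self-map of `E`, transported to the subset `U` of `X` by a chart `φ : U ≃ₜ E` and extended by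
the identity. -/
noncomputable def extendById (φ : U ≃ₜ E) (g : E → E) (x : X) : X :=
  if hx : x ∈ U then φ.symm (g (φ ⟨x, hx⟩)) else x

theorem extendById_coe (φ : U ≃ₜ E) (g : E → E) (p : U) :
    extendById φ g p = φ.symm (g (φ p)) := by
  simp [extendById]

theorem extendById_comp (φ : U ≃ₜ E) (f g : E → E) (x : X) :
    extendById φ f (extendById φ g x) = extendById φ (f ∘ g) x := by
  by_cases hx : x ∈ U
  · lift x to U using hx
    simp [extendById_coe]
  · simp [extendById, hx]

theorem extendById_id (φ : U ≃ₜ E) (x : X) : extendById φ id x = x := by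
  by_cases hx : x ∈ U
  · lift x to U using hx
    simp [extendById_coe]
  · simp [extendById, hx]

theorem extendById_eq_self (φ : U ≃ₜ E) {g : E → E} {C : Set E} (hg : ∀ y, y ∉ C → g y = y)
    {x : X} (hx : x ∉ (fun y => (φ.symm y : X)) '' C) : extendById φ g x = x := by
  by_cases hxU : x ∈ U
  · lift x to U using hxU
    rw [extendById_coe, hg, φ.symm_apply_apply]
    exact fun h => hx ⟨φ x, h, by simp⟩
  · simp [extendById, hxU]

theorem continuous_extendById [T2Space X] (hU : IsOpen U) (φ : U ≃ₜ E) {g : E → E}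
    (hgc : Continuous g) {C : Set E} (hC : IsCompact C) (hg : ∀ y, y ∉ C → g y = y) :
    Continuous (extendById φ g) := by
  have hK : IsClosed ((fun y => (φ.symm y : X)) '' C) :=
    (hC.image (continuous_subtype_val.comp φ.symm.continuous)).isClosed
  refine continuous_iff_continuousAt.2 fun x => ?_
  by_cases hx : x ∈ U
  · refine ContinuousOn.continuousAt (s := U) ?_ (hU.mem_nhds hx)
    rw [continuousOn_iff_continuous_domRestrict]
    have : U.domRestrict (extendById φ g) = fun p : U => (φ.symm (g (φ p)) : X) :=
      funext fun p => extendById_coe φ g p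
    rw [this]
    fun_prop
  · have hxK : x ∉ (fun y => (φ.symm y : X)) '' C := by
      rintro ⟨y, -, rfl⟩
      exact hx (φ.symm y).2
    refine continuousAt_id.congr ?_
    filter_upwards [hK.isOpen_compl.mem_nhds hxK] with p hp
    exact (extendById_eq_self φ hg hp).symm

/-- A compactly supported homeomorphism of a chart extends to the whole space by the identity. -/
noncomputable def Homeomorph.extendById [T2Space X] (hU : IsOpen U) (φ : U ≃ₜ E) (g : E ≃ₜ E)
    {C : Set E} (hC : IsCompact C) (hg : ∀ y, y ∉ C → g y = y) : X ≃ₜ X where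
  toFun := _root_.extendById φ g
  invFun := _root_.extendById φ g.symm
  left_inv x := by
    rw [extendById_comp, show g.symm ∘ g = id from funext g.symm_apply_apply, extendById_id]
  right_inv x := by
    rw [extendById_comp, show g ∘ g.symm = id from funext g.apply_symm_apply, extendById_id]
  continuous_toFun := continuous_extendById hU φ g.continuous hC hg
  continuous_invFun := continuous_extendById hU φ g.symm.continuous hC fun y hy =>
    g.symm_apply_eq.2 (hg y hy).symm

end Extension

/-- In any neighbourhood `V` of a point `x` with a chart to a nontrivial finite-dimensional space,
there is a homeomorphism supported in `V` whose iterates move some point other than `x` to `x` in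
the limit, while fixing `x`. -/
theorem exists_homeoOn_iterate_tendsto {X : Type u} [TopologicalSpace X] [T2Space X]
    {E : Type*} [NormedAddCommGroup E] [NormedSpace ℝ E] [FiniteDimensional ℝ E] [Nontrivial E]
    {U : Set X} (hU : IsOpen U) (φ : U ≃ₜ E) {x : X} (hx : x ∈ U) {V : Set X} (hV : V ∈ 𝓝 x) :
    ∃ h ∈ homeoOn X V, h x = x ∧ ∃ p, p ≠ x ∧ Tendsto (fun n => h^[n] p) atTop (𝓝 x) := by
  have : ProperSpace E := FiniteDimensional.proper ℝ E
  obtain ⟨r, hr, hrV⟩ : ∃ r > 0, Metric.closedBall (φ ⟨x, hx⟩) r ⊆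
      (fun y => (φ.symm y : X)) ⁻¹' V := by
    refine Metric.nhds_basis_closedBall.mem_iff.1 ?_
    refine (continuous_subtype_val.comp φ.symm.continuous).continuousAt.preimage_mem_nhds ?_
    simpa using hV
  -- Recentre and rescale the chart, so that `x` is the origin and the unit ball lies in `V`.
  let ψ : U ≃ₜ E := φ.trans ((Homeomorph.subRight (φ ⟨x, hx⟩)).trans
    (Homeomorph.smulOfNeZero r⁻¹ (inv_ne_zero hr.ne')))
  have hψ (p : U) : ψ p = r⁻¹ • (φ p - φ ⟨x, hx⟩) := rfl
  have hψx : (ψ.symm 0 : X) = x := by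
    have : ψ.symm 0 = ⟨x, hx⟩ := by rw [ψ.symm_apply_eq, hψ]; simp
    rw [this]
  have hψV : (fun y => (ψ.symm y : X)) '' Metric.closedBall 0 1 ⊆ V := by
    rintro _ ⟨y, hy, rfl⟩
    have h1 : φ (ψ.symm y) ∈ Metric.closedBall (φ ⟨x, hx⟩) r := by
      have h2 : r⁻¹ • (φ (ψ.symm y) - φ ⟨x, hx⟩) = y := by rw [← hψ, ψ.apply_symm_apply]
      rw [mem_closedBall_zero_iff, ← h2, norm_smul, norm_inv, Real.norm_of_nonneg hr.le,
        inv_mul_le_one₀ hr] at hy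
      rwa [mem_closedBall_iff_norm]
    simpa using hrV h1
  have hsupp : ∀ y : E, y ∉ Metric.closedBall 0 1 → radialHomeomorph E y = y := fun y hy =>
    radialHomeomorph_of_one_le (by rw [mem_closedBall_zero_iff, not_le] at hy; exact hy.le)
  let h := Homeomorph.extendById hU ψ (radialHomeomorph E)
    (isCompact_closedBall (0 : E) 1) hsupp
  have hh (y : E) : h (ψ.symm y) = ψ.symm (radialHomeomorph E y) := by
    refine (extendById_coe ψ _ _).trans ?_
    rw [ψ.apply_symm_apply]
  have hiter (y : E) (n : ℕ) : h^[n] (ψ.symm y) = ψ.symm ((radialHomeomorph E)^[n] y) := by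
    induction n with
    | zero => rfl
    | succ n ih => rw [Function.iterate_succ_apply', ih, hh, Function.iterate_succ_apply']
  refine ⟨h, fun p hp => extendById_eq_self ψ hsupp fun hpK => hp (hψV hpK), ?_, ?_⟩
  · rw [← hψx, hh, radialHomeomorph_apply, smul_zero]
  · obtain ⟨y, hy⟩ := exists_norm_eq E (c := 1 / 2) (by norm_num)
    refine ⟨ψ.symm y, fun heq => ?_, ?_⟩
    · rw [← hψx] at heq
      have : y = 0 := ψ.symm.injective (Subtype.ext heq)
      norm_num [this] at hy
    · simp only [hiter]
      rw [← hψx]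
      exact ((continuous_subtype_val.comp ψ.symm.continuous).tendsto 0).comp
        (tendsto_radialHomeomorph_iterate hy.le)

/-- Iterating a contraction supported near an interior point of `S` gives a sequence inside any
given compact neighbourhood of the identity; a cluster point of it could not be injective. -/
theorem LocallyEuclidean.not_locallyCompactSpace_homeoOn {X : Type u} [TopologicalSpace X]
    [T2Space X] (hX : LocallyEuclidean X) (hiso : ∀ x : X, ¬ IsOpen {x}) {S : Set X}
    (hS : (interior S).Nonempty) : ¬ LocallyCompactSpace (homeoOn X S) := by
  intro hlc
  obtain ⟨x, hxS⟩ := hS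
  obtain ⟨n, U, hU, hxU, ⟨φ⟩⟩ := hX x
  have : Nontrivial (EuclideanSpace ℝ (Fin n)) := by
    rw [← not_subsingleton_iff_nontrivial]
    intro _
    have : Subsingleton U := φ.toEquiv.subsingleton
    exact hiso x ((subsingleton_coe U |>.1 this).eq_singleton_of_mem hxU ▸ hU)
  obtain ⟨N, hN, hN1⟩ := exists_compact_mem_nhds (1 : homeoOn X S)
  obtain ⟨V, hV, hVN⟩ := homeoOn.exists_nhds_forall_mem hN1 x
  obtain ⟨h, hh, hhx, p, hpx, hp⟩ := exists_homeoOn_iterate_tendsto hU φ hxU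
    (inter_mem hV (mem_interior_iff_mem_nhds.1 hxS))
  have hhS : h ∈ homeoOn X S := homeoOn_mono X inter_subset_right hh
  let H : homeoOn X S := ⟨h, hhS⟩
  have hH (q : X) (k : ℕ) : (H ^ k).1 q = h^[k] q := by
    induction k with
    | zero => rfl
    | succ k ih =>
      rw [pow_succ', Function.iterate_succ_apply', ← ih]
      rfl
  have hHN (k : ℕ) : H ^ k ∈ N :=
    hVN _ ((homeoOn X V).pow_mem (homeoOn_mono X inter_subset_left hh) k)
  obtain ⟨z, -, hz⟩ := hN.exists_mapClusterPt (f := atTop) (u := fun k : ℕ => H ^ k)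
    (tendsto_principal.2 (Eventually.of_forall hHN))
  have hlim {q : X} (hq : Tendsto (fun k => h^[k] q) atTop (𝓝 x)) : z.1 q = x := by
    have h1 : MapClusterPt (z.1 q) atTop fun k => (H ^ k).1 q :=
      hz.continuousAt_comp (homeoOn.continuous_apply q).continuousAt
    simp only [hH] at h1
    exact eq_of_nhds_neBot (NeBot.mono h1 (inf_le_inf_left _ hq))
  refine hpx (z.1.injective ((hlim hp).trans (hlim ?_).symm))
  simp only [Function.iterate_fixed hhx]
  exact tendsto_const_nhds

theorem theoremC (X : Type u) [TopologicalSpace X] [LocallyCompactSpace X] [T2Space X]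
    [NoncompactSpace X] :
    List.Pairwise (fun p q : Prop => p → q)
      [ -- (i)
        MetrizableSpace X ∧ LocallyEuclidean X ∧ ∀ x : X, ¬ IsOpen {x},
        -- (ii)
        MetrizableSpace X ∧ ∀ U : Set X, IsOpen U → U.Nonempty → IsCompact (closure U) →
          ¬ LocallyCompactSpace (homeoOn X (closure U)),
        -- (iii)
        NormalSpace X ∧ LocallyMetrizable X ∧
          (∃ M : Set X, IsCompact M ∧ ¬ LocallyCompactSpace (homeoOn X M)) ∧
          (∃ T : Set X, IsHomeoNondiscreteSet X T),
        -- (iv)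
        (∃ M : Set X, IsCompact M ∧ MetrizableSpace M ∧ ¬ LocallyCompactSpace (homeoOn X M)) ∧
          (∃ A : Set X, A = closure (interior A) ∧ IsSigmaCompact A ∧ MetrizableSpace A ∧
            ∃ T : Set X, T ⊆ interior A ∧ IsHomeoNondiscreteSet X T),
        -- (v)
        ¬ SatisfiesACP (homeoFamily X) ] := by
  have : IsTrans Prop fun p q => p → q := ⟨fun _ _ _ hpq hqr hp => hqr (hpq hp)⟩
  rw [← List.isChain_iff_pairwise]
  simp only [List.isChain_cons_cons, List.isChain_singleton, and_true]
  refine ⟨?_, ?_, ?_, ?_⟩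
  · rintro ⟨hm, hE, hiso⟩
    exact ⟨hm, fun U hU hne _ => hE.not_locallyCompactSpace_homeoOn hiso
      (hne.mono (interior_maximal subset_closure hU))⟩
  · rintro ⟨hm, hU⟩
    refine ⟨inferInstance, fun x => ⟨univ, univ_mem, inferInstance⟩, ?_,
      exists_isHomeoNondiscreteSet X hU⟩
    have : Nonempty X := not_isEmpty_iff.1 fun _ => not_compactSpace_iff.2 ‹_› inferInstance
    obtain ⟨x⟩ := this
    obtain ⟨K, hK, hKx⟩ := exists_compact_mem_nhds x
    have hc : IsCompact (closure (interior K)) :=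
      hK.of_isClosed_subset isClosed_closure (closure_minimal interior_subset hK.isClosed)
    exact ⟨_, hc, hU _ isOpen_interior ⟨x, mem_interior_iff_mem_nhds.2 hKx⟩ hc⟩
  · rintro ⟨hn, hlm, ⟨M, hM, hMlc⟩, T, hT⟩
    exact ⟨⟨M, hM, hM.isLindelof.metrizableSpace hlm, hMlc⟩, hT.exists_regularClosed hlm⟩
  · rintro ⟨⟨M, hM, hMm, hMlc⟩, A, hA, -, hAm, T, hTA, hT⟩
    exact not_satisfiesACP_of_isHomeoNondiscreteSet hM hMlc (hA ▸ isClosed_closure) hTA hT
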